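/- Let $d\ge 1$ and $M\ge 1$ be integers, let $J=\{-2M,-2M+1,\dots,2M\}^d$, with indices read modulo $4M+1$ in each coordinate, and let $M_0=\lfloor 4M/3\rfloor$. For an image $\boldsymbol f=(f_{\boldsymbol j})_{\boldsymbol j\in J}\in\mathbb R^J$ let $$\hat f_{\boldsymbol k}=\sum_{\boldsymbol j\in J} f_{\boldsymbol j}\,e^{2\pi i\,\boldsymbol j\cdot\boldsymbol k/(4M+1)},\qquad [\boldsymbol f\star\boldsymbol f]_{\boldsymbol j}=\sum_{\boldsymbol l\in J}f_{\boldsymbol l}f_{\boldsymbol j+\boldsymbol l}\qquad(\boldsymbol j,\boldsymbol k\in J)$$ be its discrete Fourier transform and its (periodic) autocorrelation image. For $\boldsymbol a\in\mathbb R^J$ let $\mathbb A_{\boldsymbol a}=\{\boldsymbol g\in\mathbb R^J: |\hat g_{\boldsymbol k}|=a_{\boldsymbol k}\text{ for all }\boldsymbol k\in J\}$ be the magnitude torus, and let $B_+=\{\boldsymbol g\in\mathbb R^J: g_{\boldsymbol j}\ge 0\text{ for all }\boldsymbol j\in J\}$. The trivial associates of $\boldsymbol f$ are the images $\boldsymbol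 j\mapsto f_{\boldsymbol j-\boldsymbol v}$ and $\boldsymbol j\mapsto f_{\boldsymbol v-\boldsymbol j}$, $\boldsymbol v\in J$. Let $X\subset B_+$ be the set of non-negative images $\boldsymbol f$ for which the support of $\boldsymbol f\star\boldsymbol f$ is contained in $\{-M_0,\dots,M_0\}^d$. Then: 1. For every $\boldsymbol f\in X$, with $\boldsymbol a=(|\hat f_{\boldsymbol k}|)_{\boldsymbol k\in J}$, the set $\mathbb A_{\boldsymbol a}\cap B_+$ is finite. 2. If $d\ge 2$, then for generic $\boldsymbol f\in X$, with $\boldsymbol a=(|\hat f_{\boldsymbol k}|)_{\boldsymbol k\in J}$, every element of $\mathbb A_{\boldsymbol a}\cap B_+$ is a trivial associate of $\boldsymbol f$. Here generic means: there is a polynomial $p$ with real coefficients in the pixel values $(f_{\boldsymbol j})_{\boldsymbol j\in J}$, depending only on $d$ and $M$, such that $\{\boldsymbol f\in X: p(\boldsymbol f)\neq 0\}$ is dense in $X$ and the assertion holds for every $\boldsymbol f\in X$ with $p(\boldsymbol f)\ne0$. -/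

import Mathlib

namespace PhaseRetrieval

/-- The index set `J = {-2M, …, 2M}^d`, with the `J`-periodic convention: indices are read modulo
`4M + 1` in every direction. The representative of a residue in `{-2M, …, 2M}` is
`ZMod.valMinAbs`, see `coord_mem` and `exists_coord_eq`. -/
abbrev Pixel (d M : ℕ) : Type := Fin d → ZMod (4 * M + 1)

/-- Real images `f = (f_j : j ∈ J)`. -/
abbrev Image (d M : ℕ) : Type := Pixel d M → ℝ

/-- The `i`-th integer coordinate of `j ∈ J = {-2M, …, 2M}^d`. -/
def coord {d M : ℕ} (j : Pixel d M) (i : Fin d) : ℤ := (j i).valMinAbs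

theorem coord_mem {d M : ℕ} (j : Pixel d M) (i : Fin d) :
    coord j i ∈ Set.Icc (-(2 * M : ℤ)) (2 * M) := by
  have h := ZMod.valMinAbs_mem_Ioc (j i)
  simp only [Set.mem_Ioc, Set.mem_Icc, coord] at h ⊢
  push_cast at h
  constructor <;> linarith [h.1, h.2, (by omega :
    -(2 * M : ℤ) ≤ (j i).valMinAbs ∧ (j i).valMinAbs ≤ 2 * M).1, (by omega :
    -(2 * M : ℤ) ≤ (j i).valMinAbs ∧ (j i).valMinAbs ≤ 2 * M).2]

/-- Every integer point of the cube `{-2M, …, 2M}^d` is the coordinate vector of exactly one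
index. -/
theorem exists_coord_eq {d M : ℕ} (n : Fin d → ℤ)
    (hn : ∀ i, n i ∈ Set.Icc (-(2 * M : ℤ)) (2 * M)) :
    ∃! j : Pixel d M, ∀ i, coord j i = n i := by
  refine ⟨fun i => (n i : ZMod (4 * M + 1)), fun i => ?_, fun j hj => ?_⟩
  · have h := hn i
    simp only [Set.mem_Icc] at h
    refine (ZMod.valMinAbs_spec _ _).2 ⟨rfl, ?_⟩
    simp only [Set.mem_Ioc]
    push_cast
    constructor <;> omega
  · funext i
    rw [← hj i, coord, ZMod.coe_valMinAbs]

/-- The discrete Fourier transform `f̂_k = ∑_{j ∈ J} f_j exp(2πi j·k / (4M+1))`. -/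
noncomputable def dft {d M : ℕ} (f : Image d M) (k : Pixel d M) : ℂ :=
  ∑ j : Pixel d M, (f j : ℂ) *
    Complex.exp (2 * Real.pi * Complex.I * ((∑ i, coord j i * coord k i : ℤ) : ℂ) /
      ((4 * M + 1 : ℕ) : ℂ))

/-- The measurement map: the magnitude DFT data `a_k = |f̂_k|`. -/
noncomputable def magnitudeData {d M : ℕ} (f : Image d M) : Pixel d M → ℝ :=
  fun k => ‖dft f k‖

/-- The magnitude torus `A_a` of all real images with magnitude DFT data `a`. -/
def magnitudeTorus {d M : ℕ} (a : Pixel d M → ℝ) : Set (Image d M) :=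
  {f | ∀ k, ‖dft f k‖ = a k}

/-- The set `B_+` of non-negative images. -/
def nonnegImages (d M : ℕ) : Set (Image d M) :=
  {f | ∀ j, 0 ≤ f j}

/-- The periodic autocorrelation image `[f ⋆ f]_j = ∑_{l ∈ J} f_l f_{j+l}`. -/
noncomputable def autocorrelation {d M : ℕ} (f : Image d M) : Image d M :=
  fun j => ∑ l : Pixel d M, f l * f (j + l)

/-- The cube `{-m, …, m}^d` in `J`. -/
def centeredCube (d M m : ℕ) : Set (Pixel d M) :=
  {j | ∀ i, |coord j i| ≤ (m : ℤ)}

/-- The non-negative images whose autocorrelation image is supported in `{-M₀, …, M₀}^d`,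
where `M₀ = ⌊4M/3⌋`. -/
def smallAutocorrelationImages (d M : ℕ) : Set (Image d M) :=
  {f | f ∈ nonnegImages d M ∧
    Function.support (autocorrelation f) ⊆ centeredCube d M (4 * M / 3)}

/-- The trivial associates of `f`: the images generated from `f` by the periodic translations
`f_j ↦ f_{j-v}` and the inversion `f_j ↦ f_{-j}`. -/
def trivialAssociates {d M : ℕ} (f : Image d M) : Set (Image d M) :=
  {g | ∃ v : Pixel d M, (∀ j, g j = f (j - v)) ∨ (∀ j, g j = f (v - j))}

/-- The property `Q` holds for generic points of the set `X ⊆ ℝ^σ`: it can fail only on the zero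
set of one polynomial in the coordinates, whose non-zero set in `X` is dense in `X` (so that
the exceptional points lie in a relatively closed, nowhere dense, algebraic subset of `X`). -/
def HoldsGenerically {σ : Type*} (X : Set (σ → ℝ)) (Q : (σ → ℝ) → Prop) : Prop :=
  ∃ p : MvPolynomial σ ℝ,
    X ⊆ closure {f | f ∈ X ∧ MvPolynomial.eval f p ≠ 0} ∧
    ∀ f ∈ X, MvPolynomial.eval f p ≠ 0 → Q f

end PhaseRetrieval

/-!
By Fourier inversion the magnitude data of an image determine its periodic autocorrelation
(`autocorrelation_eq_of_magnitudeData_eq`). For a non-negative image no cancellation occurs in the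
autocorrelation, so its support consists of all differences of support points; if these lie in
`{-M₀, …, M₀}^d` with `3 * M₀ < 4M + 1`, then the image lives on a translate of the cube
`{0, …, M₀}^d` (`exists_eq_placed`). This applies to every non-negative image `g` with the same
magnitude data as `f`, too.

Read the pixel values on the cube as the coefficients of a polynomial `F` in `d` variables. Since
`2 * M₀ < 4M + 1`, the periodic autocorrelation has no wrap-around and amounts to the polynomial
`x ^ t * F(x) * F(1 / x)` with `t = (M₀, …, M₀)` (`autocorrPoly`). The question is then which
polynomials `G` with non-negative coefficients satisfy `G(x) * G(1 / x) = F(x) * F(1 / x)`.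

* `G` is a divisor of a fixed polynomial in a factorial ring, whose units are the constants, and
  the autocorrelation and the sign fix the constant: there are finitely many such `G`
  (`finite_nonneg_autocorrPoly_eq`).
* If `F` is irreducible of full degree, it divides `G` or the reflection of `G`, and comparing
  degrees it is equal to one of them (`eq_or_eq_comp_boxRev_of_irreducible`).

In at least two variables `F` is irreducible generically (`exists_irreducible_boxPoly`). For a
product of polynomials with exponents in the boxes `[0, t - b]` and `[0, b]` the translate
`b + [0, t - b]` and `[0, b]` meet in one point only, and together miss a point of `[0, t]`. After
normalising one coefficient, such products are therefore parametrised by fewer numbers than they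
have coefficients, and as algebraic independence is bounded by the transcendence degree, their
coefficients satisfy a polynomial relation.
-/

/-! ### Generic irreducibility of polynomials in several variables -/

open MvPolynomial in
/-- More polynomials than variables are algebraically dependent: the image of a polynomial map into
a space of larger dimension lies in a hypersurface. -/
theorem MvPolynomial.exists_ne_zero_aeval_eq_zero {K ι τ : Type*} [Field K] [Fintype ι] [Fintype τ]
    (h : Fintype.card τ < Fintype.card ι) (c : ι → MvPolynomial τ K) :
    ∃ r : MvPolynomial ι K, r ≠ 0 ∧ aeval c r = 0 := by
  by_contra! hr
  have hind : AlgebraicIndependent K c :=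
    (injective_iff_map_eq_zero _).2 fun r h0 => by_contra fun hne => hr r hne h0
  have := hind.lift_cardinalMk_le_trdeg
  rw [MvPolynomial.trdeg_of_isDomain] at this
  simp only [Cardinal.mk_fintype, Cardinal.lift_natCast, Nat.cast_le] at this
  omega

namespace PhaseRetrieval

open MvPolynomial

section GenericIrreducibility

variable {σ K : Type*} [DecidableEq σ] [Field K]

/-- The polynomial with coefficients `y`, whose exponents run through the box of all `n ≤ t`. -/
noncomputable def boxPoly (t : σ →₀ ℕ) (y : Finset.Iic t → K) : MvPolynomial σ K :=
  ∑ n, monomial n.1 (y n)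

theorem coeff_boxPoly (t : σ →₀ ℕ) (y : Finset.Iic t → K) (n : Finset.Iic t) :
    coeff n.1 (boxPoly t y) = y n := by
  classical
  simp [boxPoly, coeff_sum, coeff_monomial]

theorem coeff_boxPoly_of_not_le {t : σ →₀ ℕ} (y : Finset.Iic t → K) {n : σ →₀ ℕ} (hn : ¬ n ≤ t) :
    coeff n (boxPoly t y) = 0 := by
  classical
  rw [boxPoly, coeff_sum]
  refine Finset.sum_eq_zero fun m _ => ?_
  rw [coeff_monomial, if_neg]
  rintro rfl
  exact hn (Finset.mem_Iic.1 m.2)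

theorem boxPoly_injective (t : σ →₀ ℕ) :
    Function.Injective (boxPoly t : (Finset.Iic t → K) → MvPolynomial σ K) := fun y z h =>
  funext fun n => by rw [← coeff_boxPoly t y n, h, coeff_boxPoly]

theorem C_mul_boxPoly (t : σ →₀ ℕ) (c : K) (y : Finset.Iic t → K) :
    C c * boxPoly t y = boxPoly t fun n => c * y n := by
  simp [boxPoly, Finset.mul_sum, C_mul_monomial]

theorem degreeOf_boxPoly_le (t : σ →₀ ℕ) (y : Finset.Iic t → K) (i : σ) :
    degreeOf i (boxPoly t y) ≤ t i := by
  refine degreeOf_le_iff.2 fun n hn => ?_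
  by_contra hlt
  exact mem_support_iff.1 hn (coeff_boxPoly_of_not_le y fun hle => hlt (hle i))

theorem degreeOf_boxPoly {t : σ →₀ ℕ} {y : Finset.Iic t → K}
    (hy : y ⟨t, Finset.mem_Iic.2 le_rfl⟩ ≠ 0) (i : σ) : degreeOf i (boxPoly t y) = t i := by
  refine le_antisymm (degreeOf_boxPoly_le t y i) (monomial_le_degreeOf i ?_)
  rw [mem_support_iff]
  have := coeff_boxPoly t y ⟨t, Finset.mem_Iic.2 le_rfl⟩
  simpa [this] using hy

theorem eq_C_of_degreeOf_eq_zero {σ K : Type*} [Field K] {p : MvPolynomial σ K}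
    (h : ∀ i, degreeOf i p = 0) :
    p = C (coeff 0 p) := by
  rw [← totalDegree_eq_zero_iff_eq_C, totalDegree_eq_zero_iff]
  intro n hn i
  exact Nat.le_zero.1 ((monomial_le_degreeOf i hn).trans (h i).le)

/-- Dimension count for products `A * B`, where the exponents of `A` and `B` lie in the boxes with
corners `t - b` and `b`. If the translated box `b + [0, t - b]` and `[0, b]`, which meet in `b` only,
miss a point `x` of `[0, t]`, then the products with `A` of constant term `1` are parametrised by
at most `#[0, t] - 1` coefficients, so that their coefficient vectors lie on a hypersurface. -/
theorem exists_relation_of_mul {t b x : σ →₀ ℕ} (hbt : b ≤ t) (hxt : x ≤ t) (hxb : ¬ x ≤ b)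
    (hbx : ¬ b ≤ x) :
    ∃ r : MvPolynomial (Finset.Iic t) K, r ≠ 0 ∧ ∀ A B : MvPolynomial σ K, coeff 0 A ≠ 0 →
      (∀ n, coeff n A ≠ 0 → b + n ≤ t) → (∀ n, coeff n B ≠ 0 → n ≤ b) →
      eval (fun n : Finset.Iic t => coeff n.1 (A * B)) r = 0 := by
  classical
  let τ := {z : Finset.Iic t // z ≠ ⟨x, Finset.mem_Iic.2 hxt⟩}
  -- The parameter at `z` is the coefficient of `B` at `z` if `z ≤ b`, and that of `A` at `z - b` if
  -- `b < z`; there is none at `x`.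
  let V : (σ →₀ ℕ) → MvPolynomial τ K := fun z =>
    if h : z ≤ t ∧ z ≠ x then X ⟨⟨z, Finset.mem_Iic.2 h.1⟩, fun e => h.2 (congrArg Subtype.val e)⟩
    else 0
  let c : Finset.Iic t → MvPolynomial τ K := fun n =>
    ∑ p ∈ Finset.HasAntidiagonal.antidiagonal n.1,
      (if p.1 = 0 then 1 else V (b + p.1)) * (if p.2 ≤ b then V p.2 else 0)
  have hcard : Fintype.card τ < Fintype.card (Finset.Iic t) :=
    Fintype.card_subtype_lt (x := ⟨x, Finset.mem_Iic.2 hxt⟩) (by simp)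
  obtain ⟨r, hr0, hr⟩ := MvPolynomial.exists_ne_zero_aeval_eq_zero hcard c
  refine ⟨r, hr0, ?_⟩
  have key : ∀ A B : MvPolynomial σ K, coeff 0 A = 1 →
      (∀ n, coeff n A ≠ 0 → b + n ≤ t) → (∀ n, coeff n B ≠ 0 → n ≤ b) →
      eval (fun n : Finset.Iic t => coeff n.1 (A * B)) r = 0 := by
    intro A B hA0 hA hB
    let val : τ → K := fun z =>
      if z.1.1 ≤ b then coeff z.1.1 B else if b ≤ z.1.1 then coeff (z.1.1 - b) A else 0
    have hc : ∀ n, eval val (c n) = coeff n.1 (A * B) := by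
      intro n
      rw [coeff_mul, map_sum]
      refine Finset.sum_congr rfl fun p _ => ?_
      rw [map_mul]
      congr 1
      · split_ifs with h0
        · rw [h0, hA0, map_one]
        · by_cases ht : b + p.1 ≤ t
          · have hx : b + p.1 ≠ x := fun e => hbx (e ▸ le_self_add)
            have hnb : ¬ b + p.1 ≤ b := fun h => h0 (by simpa using h)
            simp [V, val, ht, hx, hnb]
          · have : coeff p.1 A = 0 := by
              by_contra h
              exact ht (hA _ h)
            simp [V, ht, this]
      · split_ifs with hb
        · have hx : p.2 ≠ x := fun e => hxb (e ▸ hb)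
          simp [V, val, hb.trans hbt, hx, hb]
        · have : coeff p.2 B = 0 := by
            by_contra h
            exact hb (hB _ h)
          simp [this]
    have h1 : eval val (aeval c r) = eval (fun n => eval val (c n)) r := by
      rw [← bind₁, eval, eval₂Hom_bind₁]
      rfl
    rw [hr, map_zero] at h1
    simpa only [hc] using h1.symm
  intro A B hA0 hA hB
  have hAB : A * B = (C (coeff 0 A)⁻¹ * A) * (C (coeff 0 A) * B) := by
    have : (C (coeff 0 A)⁻¹ * C (coeff 0 A) : MvPolynomial σ K) = 1 := by
      rw [← C_mul, inv_mul_cancel₀ hA0, C_1]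
    calc A * B = (C (coeff 0 A)⁻¹ * C (coeff 0 A)) * (A * B) := by rw [this, one_mul]
      _ = _ := by ring
  rw [hAB]
  refine key _ _ (by rw [coeff_C_mul, inv_mul_cancel₀ hA0]) (fun n hn => hA n ?_) fun n hn => hB n ?_
  · rw [coeff_C_mul] at hn
    exact right_ne_zero_of_mul hn
  · rw [coeff_C_mul] at hn
    exact right_ne_zero_of_mul hn

/-- The corner `x` of the box that changes one coordinate of `b` to the maximum and the others to
`0` escapes both boxes of `exists_relation_of_mul`. In one variable there is no such point. -/
theorem exists_incomparable {σ : Type*} [Nontrivial σ] {t b : σ →₀ ℕ} (ht : ∀ i, 0 < t i)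
    (hbt : b ≤ t) (hb0 : b ≠ 0) (hb : b ≠ t) : ∃ x, x ≤ t ∧ ¬ x ≤ b ∧ ¬ b ≤ x := by
  have main : ∀ i k, i ≠ k → b i < t i → 0 < b k → ∃ x, x ≤ t ∧ ¬ x ≤ b ∧ ¬ b ≤ x := by
    intro i k hik hi hk
    refine ⟨Finsupp.single i (t i), by simp, fun h => ?_, fun h => ?_⟩
    · exact absurd (h i) (by simpa using hi)
    · exact absurd (h k) (by simpa [Finsupp.single_apply, hik] using hk.ne')
  obtain ⟨i, hi⟩ : ∃ i, b i < t i := by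
    by_contra! h
    exact hb (le_antisymm hbt h)
  obtain ⟨k, hk⟩ := Finsupp.ne_iff.1 hb0
  have hk : 0 < b k := Nat.pos_of_ne_zero hk
  rcases ne_or_eq i k with hik | rfl
  · exact main i k hik hi hk
  obtain ⟨j, hj⟩ := exists_ne i
  rcases Nat.eq_zero_or_pos (b j) with h0 | hpos
  · exact main j i hj (h0 ▸ ht j) hk
  · exact main i j hj.symm hi hpos

/-- In at least two variables a generic polynomial with exponents `n ≤ t` is irreducible. -/
theorem exists_irreducible_boxPoly [Finite σ] [Nontrivial σ] {t : σ →₀ ℕ} (ht : ∀ i, 0 < t i) :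
    ∃ r : MvPolynomial (Finset.Iic t) K, r ≠ 0 ∧
      ∀ y, (∀ n, y n ≠ 0) → eval y r ≠ 0 → Irreducible (boxPoly t y) := by
  classical
  have hrel : ∀ b : σ →₀ ℕ, ∃ r : MvPolynomial (Finset.Iic t) K, r ≠ 0 ∧
      (b ≤ t → b ≠ 0 → b ≠ t → ∀ A B : MvPolynomial σ K, coeff 0 A ≠ 0 →
        (∀ n, coeff n A ≠ 0 → b + n ≤ t) → (∀ n, coeff n B ≠ 0 → n ≤ b) →
        eval (fun n : Finset.Iic t => coeff n.1 (A * B)) r = 0) := by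
    intro b
    by_cases h : b ≤ t ∧ b ≠ 0 ∧ b ≠ t
    · obtain ⟨x, h1, h2, h3⟩ := exists_incomparable ht h.1 h.2.1 h.2.2
      obtain ⟨r, hr, hr'⟩ := exists_relation_of_mul (K := K) h.1 h1 h2 h3
      exact ⟨r, hr, fun _ _ _ => hr'⟩
    · exact ⟨1, one_ne_zero, fun h1 h2 h3 => absurd ⟨h1, h2, h3⟩ h⟩
  choose r hr0 hr using hrel
  refine ⟨∏ b ∈ Finset.Iic t, r b, Finset.prod_ne_zero_iff.2 fun b _ => hr0 b, ?_⟩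
  intro y hy hev
  have hy0 := coeff_boxPoly t y ⟨0, Finset.mem_Iic.2 zero_le⟩
  have hdeg : ∀ i, degreeOf i (boxPoly t y) = t i := degreeOf_boxPoly (hy _)
  have hne : boxPoly t y ≠ 0 := by
    intro h
    rw [h, coeff_zero] at hy0
    exact hy _ hy0.symm
  obtain ⟨i₀⟩ : Nonempty σ := inferInstance
  refine ⟨fun hu => ?_, fun A B hAB => ?_⟩
  · obtain ⟨c, -, hc⟩ := isUnit_iff_eq_C_of_isReduced.1 hu
    have := hdeg i₀
    rw [hc, degreeOf_C] at this
    exact (ht i₀).ne this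
  have hA : A ≠ 0 := by
    rintro rfl
    exact hne (by rw [hAB, zero_mul])
  have hB : B ≠ 0 := by
    rintro rfl
    exact hne (by rw [hAB, mul_zero])
  have hadd : ∀ i, degreeOf i A + degreeOf i B = t i := fun i => by
    rw [← degreeOf_mul_eq hA hB, ← hAB, hdeg]
  have hunit : ∀ p : MvPolynomial σ K, p ≠ 0 → (∀ i, degreeOf i p = 0) → IsUnit p := by
    intro p hp h
    rw [eq_C_of_degreeOf_eq_zero h] at hp ⊢
    exact (isUnit_iff_ne_zero.2 fun h0 => hp (by rw [h0, C_0])).map C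
  by_contra! hcon
  let b : σ →₀ ℕ := Finsupp.equivFunOnFinite.symm fun i => degreeOf i B
  have hbi : ∀ i, b i = degreeOf i B := fun i => rfl
  have hbt : b ≤ t := fun i => by
    have := hadd i
    rw [hbi]
    omega
  have hb0 : b ≠ 0 := fun h => hcon.2 (hunit B hB fun i => by rw [← hbi, h]; rfl)
  have hbne : b ≠ t := fun h => hcon.1 (hunit A hA fun i => by
    have := hadd i
    rw [← hbi, h] at this
    omega)
  refine hev ?_
  rw [map_prod]
  refine Finset.prod_eq_zero (Finset.mem_Iic.2 hbt) ?_
  have hcoeff : y = fun n : Finset.Iic t => coeff n.1 (A * B) :=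
    funext fun n => by rw [← hAB, coeff_boxPoly]
  rw [hcoeff]
  refine hr b hbt hb0 hbne A B ?_ ?_ ?_
  · intro h
    have h2 : coeff 0 (A * B) = 0 := by
      have := map_mul (constantCoeff (R := K) (σ := σ)) A B
      simpa [constantCoeff_eq, h] using this
    rw [← hAB] at h2
    exact hy _ (hy0.symm.trans h2)
  · intro n hn i
    have := monomial_le_degreeOf i (mem_support_iff.2 hn)
    have := hadd i
    rw [Finsupp.add_apply, hbi]
    omega
  · intro n hn i
    exact monomial_le_degreeOf i (mem_support_iff.2 hn)

end GenericIrreducibility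

/-! ### Polynomials with a given autocorrelation -/

section Reversal

variable {σ K : Type*} [DecidableEq σ]

/-- The point reflection `n ↦ t - n` of the box of all `n ≤ t`. -/
noncomputable def boxRev (t : σ →₀ ℕ) : Equiv.Perm (Finset.Iic t) where
  toFun n := ⟨t - n.1, Finset.mem_Iic.2 tsub_le_self⟩
  invFun n := ⟨t - n.1, Finset.mem_Iic.2 tsub_le_self⟩
  left_inv n := Subtype.ext (tsub_tsub_cancel_of_le (Finset.mem_Iic.1 n.2))
  right_inv n := Subtype.ext (tsub_tsub_cancel_of_le (Finset.mem_Iic.1 n.2))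

@[simp]
theorem boxRev_coe (t : σ →₀ ℕ) (n : Finset.Iic t) : (boxRev t n).1 = t - n.1 := rfl

theorem boxRev_boxRev (t : σ →₀ ℕ) (n : Finset.Iic t) : boxRev t (boxRev t n) = n :=
  (boxRev t).left_inv n

/-- The polynomial `x ^ t * F(x) * F(1 / x)`, where `F = boxPoly t y`. Its coefficients are those of
the aperiodic autocorrelation of `y`, shifted by `t`. -/
noncomputable def autocorrPoly [Field K] (t : σ →₀ ℕ) (y : Finset.Iic t → K) : MvPolynomial σ K :=
  boxPoly t y * boxPoly t (y ∘ boxRev t)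

theorem coeff_autocorrPoly [Field K] (t : σ →₀ ℕ) (y : Finset.Iic t → K) (n : σ →₀ ℕ) :
    coeff n (autocorrPoly t y) = ∑ b, ∑ a, if a.1 + (t - b.1) = n then y b * y a else 0 := by
  have hrev : boxPoly t (y ∘ boxRev t) = ∑ b, monomial (t - b.1) (y b) := by
    rw [boxPoly, ← Equiv.sum_comp (boxRev t)]
    simp [boxRev_boxRev]
  rw [autocorrPoly, hrev, boxPoly, Finset.sum_mul_sum, Finset.sum_comm, coeff_sum]
  refine Finset.sum_congr rfl fun b _ => ?_
  rw [coeff_sum]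
  refine Finset.sum_congr rfl fun a _ => ?_
  rw [monomial_mul, coeff_monomial, mul_comm]

theorem autocorrPoly_comp_boxRev [Field K] (t : σ →₀ ℕ) (y : Finset.Iic t → K) :
    autocorrPoly t (y ∘ boxRev t) = autocorrPoly t y := by
  have : (y ∘ boxRev t) ∘ boxRev t = y := funext fun n => congrArg y (boxRev_boxRev t n)
  rw [autocorrPoly, this, mul_comm, autocorrPoly]

theorem boxPoly_eq_zero_iff [Field K] {t : σ →₀ ℕ} {y : Finset.Iic t → K} :
    boxPoly t y = 0 ↔ y = 0 := by
  have h0 : boxPoly t (0 : Finset.Iic t → K) = 0 := by simp [boxPoly]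
  exact ⟨fun h => boxPoly_injective t (h.trans h0.symm), fun h => h ▸ h0⟩

theorem autocorrPoly_eq_zero_iff [Field K] {t : σ →₀ ℕ} {y : Finset.Iic t → K} :
    autocorrPoly t y = 0 ↔ y = 0 := by
  rw [autocorrPoly, mul_eq_zero, boxPoly_eq_zero_iff, boxPoly_eq_zero_iff, or_iff_left_iff_imp]
  intro h
  funext n
  simpa [boxRev_boxRev] using congrFun h (boxRev t n)

/-- Among proportional non-negative vectors the autocorrelation fixes the scale. -/
theorem eq_of_C_mul_boxPoly {t : σ →₀ ℕ} {y z : Finset.Iic t → ℝ} (hy : ∀ n, 0 ≤ y n)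
    (hz : ∀ n, 0 ≤ z n) (h : autocorrPoly t z = autocorrPoly t y) {c : ℝ}
    (hc : boxPoly t z = C c * boxPoly t y) : z = y := by
  rw [C_mul_boxPoly] at hc
  have hzy : z = fun n => c * y n := boxPoly_injective t hc
  by_cases h0 : y = 0
  · subst h0
    rw [hzy]
    funext n
    simp
  have hsq : c * c = 1 := by
    have hmul : C (c * c) * autocorrPoly t y = 1 * autocorrPoly t y :=
      calc C (c * c) * autocorrPoly t y
          = C c * boxPoly t y * (C c * boxPoly t (y ∘ boxRev t)) := by
            rw [autocorrPoly, C_mul, mul_mul_mul_comm]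
        _ = autocorrPoly t z := by rw [C_mul_boxPoly, C_mul_boxPoly, hzy]; rfl
        _ = 1 * autocorrPoly t y := by rw [h, one_mul]
    have := mul_right_cancel₀ (autocorrPoly_eq_zero_iff.not.2 h0) hmul
    rwa [← C_1, C_inj] at this
  obtain ⟨n, hn⟩ := Function.ne_iff.1 h0
  have hn : 0 < y n := lt_of_le_of_ne (hy n) (Ne.symm hn)
  have hcn : 0 ≤ c * y n := by
    have := hz n
    rwa [hzy] at this
  have hc0 : 0 ≤ c := nonneg_of_mul_nonneg_left hcn hn
  have hc1 : c = 1 := by nlinarith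
  rw [hzy, hc1]
  simp

/-- All such `z` give divisors of `P`, of which there are finitely many up to units, and different
`z` are never associated. For `P = 0` only `z = 0` is left. -/
theorem finite_nonneg_autocorrPoly_eq [Finite σ] (t : σ →₀ ℕ) (P : MvPolynomial σ ℝ) :
    {z : Finset.Iic t → ℝ | (∀ n, 0 ≤ z n) ∧ autocorrPoly t z = P}.Finite := by
  by_cases hP : P = 0
  · refine (Set.finite_singleton 0).subset ?_
    rintro z ⟨-, hz⟩
    exact autocorrPoly_eq_zero_iff.1 (hz.trans hP)
  have hfin : {a : Associates (MvPolynomial σ ℝ) | a ∣ Associates.mk P}.Finite :=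
    @Set.toFinite _ _ (@Finite.of_fintype _ (UniqueFactorizationMonoid.fintypeSubtypeDvd
      (Associates.mk P) (Associates.mk_ne_zero.2 hP)))
  refine Set.Finite.of_finite_image (f := fun z => Associates.mk (boxPoly t z))
    (hfin.subset ?_) ?_
  · rintro _ ⟨z, hz, rfl⟩
    exact Associates.mk_le_mk_of_dvd ⟨_, hz.2.symm⟩
  · rintro z hz y hy h
    obtain ⟨u, hu⟩ := (Associates.mk_eq_mk_iff_associated.1 h).symm
    obtain ⟨c, -, hc⟩ := isUnit_iff_eq_C_of_isReduced.1 u.isUnit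
    exact eq_of_C_mul_boxPoly hy.1 hz.1 (hz.2.trans hy.2.symm) (by rw [← hu, hc, mul_comm])

/-- An irreducible factor of the autocorrelation of `z` whose degree is as large as the box allows
is, up to a constant, the polynomial of `z` or of its reflection. -/
theorem eq_or_eq_comp_boxRev_of_irreducible [Finite σ] {t : σ →₀ ℕ} {y z : Finset.Iic t → ℝ}
    (hy : ∀ n, 0 ≤ y n) (hyt : y ⟨t, Finset.mem_Iic.2 le_rfl⟩ ≠ 0) (hz : ∀ n, 0 ≤ z n)
    (hirr : Irreducible (boxPoly t y)) (h : autocorrPoly t z = autocorrPoly t y) :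
    z = y ∨ z = y ∘ boxRev t := by
  have main : ∀ z : Finset.Iic t → ℝ, (∀ n, 0 ≤ z n) → autocorrPoly t z = autocorrPoly t y →
      boxPoly t y ∣ boxPoly t z → z = y := by
    rintro z hz h ⟨H, hH⟩
    have hz0 : boxPoly t z ≠ 0 := by
      intro h0
      rw [autocorrPoly, h0, zero_mul, eq_comm, autocorrPoly_eq_zero_iff] at h
      exact hyt (congrFun h _)
    have hH0 : H ≠ 0 := by
      rintro rfl
      exact hz0 (by rw [hH, mul_zero])
    have hHC : H = C (coeff 0 H) := by
      refine eq_C_of_degreeOf_eq_zero fun i => ?_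
      have h1 := degreeOf_boxPoly_le t z i
      rw [hH, degreeOf_mul_eq hirr.ne_zero hH0, degreeOf_boxPoly hyt] at h1
      omega
    exact eq_of_C_mul_boxPoly hy hz h (by rw [hH, mul_comm, ← hHC])
  have hdvd : boxPoly t y ∣ boxPoly t z * boxPoly t (z ∘ boxRev t) := ⟨_, h⟩
  rcases hirr.prime.dvd_or_dvd hdvd with h1 | h1
  · exact Or.inl (main z hz h h1)
  · have := main (z ∘ boxRev t) (fun n => hz _) ((autocorrPoly_comp_boxRev t z).trans h) h1
    right
    rw [← this]
    exact funext fun n => (congrArg z (boxRev_boxRev t n)).symm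

end Reversal

/-! ### Magnitude data and autocorrelation -/

section Fourier

variable {d M : ℕ}

/-- The character `j ↦ exp(2πi j·k / (4M+1))` as a product of characters of `ZMod (4M+1)`. -/
noncomputable def pixelChar (k j : Pixel d M) : ℂ := ∏ i, ZMod.stdAddChar (k i * j i)

theorem pixelChar_add (k j l : Pixel d M) :
    pixelChar k (j + l) = pixelChar k j * pixelChar k l := by
  simp [pixelChar, mul_add, AddChar.map_add_eq_mul, Finset.prod_mul_distrib]

theorem conj_pixelChar (k j : Pixel d M) :
    (starRingEnd ℂ) (pixelChar k j) = pixelChar k (-j) := by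
  simp only [pixelChar, map_prod, Pi.neg_apply, mul_neg, ZMod.stdAddChar_apply,
    AddChar.map_neg_eq_inv, Circle.coe_inv, ← Circle.coe_inv_eq_conj]

theorem sum_pixelChar (j : Pixel d M) :
    ∑ k, pixelChar k j = if j = 0 then (Fintype.card (Pixel d M) : ℂ) else 0 := by
  classical
  have h := Finset.prod_univ_sum (fun _ : Fin d => (Finset.univ : Finset (ZMod (4 * M + 1))))
    fun i x => (ZMod.stdAddChar (x * j i) : ℂ)
  rw [Fintype.piFinset_univ] at h
  simp only [pixelChar]
  rw [← h]
  simp only [AddChar.sum_mulShift _ (ZMod.isPrimitive_stdAddChar _)]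
  split_ifs with h0
  · subst h0
    simp
  · obtain ⟨i, hi⟩ := Function.ne_iff.1 h0
    refine Finset.prod_eq_zero (Finset.mem_univ i) ?_
    rw [if_neg (show j i ≠ 0 from hi), Nat.cast_zero]

theorem dft_eq_sum_pixelChar (f : Image d M) (k : Pixel d M) :
    dft f k = ∑ j, (f j : ℂ) * pixelChar k j := by
  refine Finset.sum_congr rfl fun j _ => ?_
  congr 1
  have : ∀ i, k i * j i = ((coord j i * coord k i : ℤ) : ZMod (4 * M + 1)) := fun i => by
    simp [coord, mul_comm]
  simp only [pixelChar, this, ZMod.stdAddChar_coe, ← Complex.exp_sum]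
  rw [← Finset.sum_div, ← Finset.mul_sum, Int.cast_sum]

/-- The Fourier transform of the autocorrelation image is the squared magnitude. -/
theorem sum_autocorrelation_mul_pixelChar (f : Image d M) (k : Pixel d M) :
    ∑ j, (autocorrelation f j : ℂ) * pixelChar k j = (magnitudeData f k : ℂ) ^ 2 := by
  rw [magnitudeData, ← Complex.mul_conj', dft_eq_sum_pixelChar, map_sum, Finset.sum_mul_sum,
    Finset.sum_comm]
  simp only [autocorrelation, Complex.ofReal_sum, Finset.sum_mul]
  rw [Finset.sum_comm]
  refine Finset.sum_congr rfl fun l _ => ?_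
  rw [← Equiv.sum_comp (Equiv.addRight l) fun j => (f j : ℂ) * pixelChar k j *
    (starRingEnd ℂ) ((f l : ℂ) * pixelChar k l)]
  refine Finset.sum_congr rfl fun j _ => ?_
  have h1 : pixelChar k l * pixelChar k (-l) = 1 := by
    rw [← pixelChar_add, add_neg_cancel]
    simp [pixelChar]
  simp only [Equiv.coe_addRight, map_mul, Complex.conj_ofReal, conj_pixelChar, pixelChar_add,
    Complex.ofReal_mul]
  linear_combination (-(f l : ℂ) * f (j + l) * pixelChar k j) * h1

/-- Fourier inversion: the magnitude data determine the autocorrelation image. -/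
theorem autocorrelation_eq_of_magnitudeData_eq {f g : Image d M}
    (h : magnitudeData f = magnitudeData g) : autocorrelation f = autocorrelation g := by
  have inversion : ∀ (a : Image d M) (l : Pixel d M),
      ∑ k, (∑ j, (a j : ℂ) * pixelChar k j) * pixelChar k (-l) =
        Fintype.card (Pixel d M) * a l := by
    intro a l
    simp only [Finset.sum_mul]
    rw [Finset.sum_comm]
    have : ∀ j, ∑ k, (a j : ℂ) * pixelChar k j * pixelChar k (-l) =
        if j = l then (Fintype.card (Pixel d M) : ℂ) * a l else 0 := by
      intro j
      simp only [mul_assoc, ← pixelChar_add]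
      rw [← Finset.mul_sum, sum_pixelChar, ← sub_eq_add_neg]
      simp only [sub_eq_zero]
      split_ifs with hj
      · rw [hj, mul_comm]
      · rw [mul_zero]
    simp [this]
  funext l
  have hf := inversion (autocorrelation f) l
  have hg := inversion (autocorrelation g) l
  simp only [sum_autocorrelation_mul_pixelChar] at hf hg
  rw [h, hg] at hf
  exact_mod_cast (mul_left_cancel₀ (Nat.cast_ne_zero.2 Fintype.card_ne_zero) hf).symm

end Fourier

/-! ### Images supported on small cubes -/

section SmallImages

variable {d M : ℕ}

/-- The exponent `(M₀, …, M₀)` with `M₀ = ⌊4M/3⌋`. -/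
noncomputable def corner (d M : ℕ) : Fin d →₀ ℕ :=
  Finsupp.equivFunOnFinite.symm fun _ => 4 * M / 3

@[simp]
theorem corner_apply (i : Fin d) : corner d M i = 4 * M / 3 := rfl

theorem le_corner (n : Finset.Iic (corner d M)) (i : Fin d) : n.1 i ≤ 4 * M / 3 :=
  Finset.mem_Iic.1 n.2 i

theorem natCast_inj_of_lt {a b : ℕ} (ha : a < 4 * M + 1) (hb : b < 4 * M + 1) :
    (a : ZMod (4 * M + 1)) = b ↔ a = b := by
  rw [ZMod.natCast_eq_natCast_iff', Nat.mod_eq_of_lt ha, Nat.mod_eq_of_lt hb]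

/-- The pixel with coordinates `n ∈ {0, …, M₀}^d`. -/
def toPixel (n : Finset.Iic (corner d M)) : Pixel d M := fun i => (n.1 i : ZMod (4 * M + 1))

theorem toPixel_injective : Function.Injective (toPixel (d := d) (M := M)) := by
  intro a b h
  refine Subtype.ext (Finsupp.ext fun i => ?_)
  have ha := le_corner a i
  have hb := le_corner b i
  exact (natCast_inj_of_lt (by omega) (by omega)).1 (congrFun h i)

theorem toPixel_boxRev (n : Finset.Iic (corner d M)) (i : Fin d) :
    toPixel (boxRev (corner d M) n) i = ((4 * M / 3 : ℕ) : ZMod (4 * M + 1)) - toPixel n i := by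
  have := le_corner n i
  simp only [toPixel, boxRev_coe, Finsupp.tsub_apply, corner_apply]
  rw [Nat.cast_sub this]

/-- The image that carries the pixel values `y` on the cube `v + {0, …, M₀}^d` and vanishes
elsewhere. -/
noncomputable def placed (v : Pixel d M) (y : Finset.Iic (corner d M) → ℝ) : Image d M :=
  fun j => ∑ n, if v + toPixel n = j then y n else 0

@[simp]
theorem placed_add_toPixel (v : Pixel d M) (y : Finset.Iic (corner d M) → ℝ)
    (n : Finset.Iic (corner d M)) : placed v y (v + toPixel n) = y n := by
  simp [placed, toPixel_injective.eq_iff]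

theorem placed_eq_zero {v j : Pixel d M} (y : Finset.Iic (corner d M) → ℝ)
    (hj : ∀ n : Finset.Iic (corner d M), v + toPixel n ≠ j) : placed v y j = 0 :=
  Finset.sum_eq_zero fun n _ => if_neg (hj n)

theorem placed_nonneg (v : Pixel d M) {y : Finset.Iic (corner d M) → ℝ} (hy : ∀ n, 0 ≤ y n) :
    placed v y ∈ nonnegImages d M := fun j => Finset.sum_nonneg fun n _ => by
  split_ifs
  exacts [hy n, le_rfl]

theorem eq_placed {f : Image d M} {v : Pixel d M}
    (h : ∀ j, f j ≠ 0 → ∃ n : Finset.Iic (corner d M), v + toPixel n = j) :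
    f = placed v fun n => f (v + toPixel n) := by
  funext j
  by_cases hj : ∃ n : Finset.Iic (corner d M), v + toPixel n = j
  · obtain ⟨n, rfl⟩ := hj
    rw [placed_add_toPixel]
  · rw [placed_eq_zero _ fun n hn => hj ⟨n, hn⟩]
    by_contra h0
    exact hj (h j h0)

theorem placed_sub (v w j : Pixel d M) (y : Finset.Iic (corner d M) → ℝ) :
    placed v y (j - w) = placed (v + w) y j := by
  refine Finset.sum_congr rfl fun n _ => ?_
  exact if_congr (by rw [eq_sub_iff_add_eq, add_right_comm]) rfl rfl

theorem placed_comp_boxRev (v j : Pixel d M) (y : Finset.Iic (corner d M) → ℝ) :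
    placed v (y ∘ boxRev (corner d M)) j =
      placed v y ((v + v + fun _ => ((4 * M / 3 : ℕ) : ZMod (4 * M + 1))) - j) := by
  rw [placed, ← Equiv.sum_comp (boxRev (corner d M))]
  refine Finset.sum_congr rfl fun n _ => ?_
  simp only [Function.comp_apply, boxRev_boxRev]
  congr 1
  rw [eq_iff_iff, funext_iff, funext_iff]
  refine forall_congr' fun i => ?_
  simp only [Pi.add_apply, Pi.sub_apply, toPixel_boxRev]
  constructor <;> intro h
  · rw [← h]
    ring
  · rw [eq_sub_iff_add_eq] at h
    linear_combination -h

theorem autocorrelation_placed (v j : Pixel d M) (y : Finset.Iic (corner d M) → ℝ) :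
    autocorrelation (placed v y) j =
      ∑ b, ∑ a, if toPixel a = j + toPixel b then y b * y a else 0 := by
  have h1 : autocorrelation (placed v y) j =
      ∑ l, ∑ b, if v + toPixel b = l then y b * placed v y (j + l) else 0 := by
    refine Finset.sum_congr rfl fun l _ => ?_
    rw [placed, Finset.sum_mul]
    refine Finset.sum_congr rfl fun b _ => ?_
    rw [ite_mul, zero_mul]
  rw [h1, Finset.sum_comm]
  refine Finset.sum_congr rfl fun b _ => ?_
  rw [Finset.sum_ite_eq, if_pos (Finset.mem_univ _), placed, Finset.mul_sum]
  refine Finset.sum_congr rfl fun a _ => ?_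
  rw [mul_ite, mul_zero]
  exact if_congr (by rw [add_left_comm, add_right_inj]) rfl rfl

/-- As `2 * M₀ < 4M + 1`, no wrap-around occurs: the periodic autocorrelation of an image on a cube
of side `M₀` consists of the coefficients of its autocorrelation polynomial. -/
theorem coeff_autocorrPoly_eq (v : Pixel d M) (y : Finset.Iic (corner d M) → ℝ) {n : Fin d →₀ ℕ}
    (hn : n ≤ 2 • corner d M) :
    coeff n (autocorrPoly (corner d M) y) = autocorrelation (placed v y)
      fun i => (n i : ZMod (4 * M + 1)) - ((4 * M / 3 : ℕ) : ZMod (4 * M + 1)) := by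
  rw [coeff_autocorrPoly, autocorrelation_placed]
  refine Finset.sum_congr rfl fun b _ => Finset.sum_congr rfl fun a _ => ?_
  congr 1
  rw [eq_iff_iff, Finsupp.ext_iff, funext_iff]
  refine forall_congr' fun i => ?_
  have ha := le_corner a i
  have hb := le_corner b i
  have hni : n i ≤ 2 * (4 * M / 3) := by simpa using hn i
  rw [← natCast_inj_of_lt (M := M) (by simp; omega) (by omega)]
  simp only [toPixel, Finsupp.add_apply, Finsupp.tsub_apply, corner_apply, Pi.add_apply]
  rw [Nat.cast_add, Nat.cast_sub hb]
  constructor <;> intro h <;> linear_combination h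

theorem autocorrPoly_eq_of_autocorrelation_eq {v w : Pixel d M}
    {y z : Finset.Iic (corner d M) → ℝ}
    (h : autocorrelation (placed v y) = autocorrelation (placed w z)) :
    autocorrPoly (corner d M) y = autocorrPoly (corner d M) z := by
  have hout : ∀ (x : Finset.Iic (corner d M) → ℝ) {n : Fin d →₀ ℕ}, ¬ n ≤ 2 • corner d M →
      coeff n (autocorrPoly (corner d M) x) = 0 := by
    intro x n hn
    rw [coeff_autocorrPoly]
    refine Finset.sum_eq_zero fun b _ => Finset.sum_eq_zero fun a _ => if_neg ?_
    rintro rfl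
    exact hn ((add_le_add (Finset.mem_Iic.1 a.2) tsub_le_self).trans_eq (two_nsmul _).symm)
  ext n
  by_cases hn : n ≤ 2 • corner d M
  · rw [coeff_autocorrPoly_eq v y hn, coeff_autocorrPoly_eq w z hn, h]
  · rw [hout y hn, hout z hn]

theorem coord_eq_of_cast_eq {j : Pixel d M} {i : Fin d} {x : ℤ} (h : j i = (x : ZMod (4 * M + 1)))
    (hx : |x| ≤ 2 * M) : coord j i = x := by
  refine (ZMod.valMinAbs_spec _ _).2 ⟨h, ?_⟩
  have := abs_le.1 hx
  simp only [Set.mem_Ioc]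
  push_cast
  constructor <;> omega

theorem placed_mem_smallAutocorrelationImages (v : Pixel d M) {y : Finset.Iic (corner d M) → ℝ}
    (hy : ∀ n, 0 ≤ y n) : placed v y ∈ smallAutocorrelationImages d M := by
  refine ⟨placed_nonneg v hy, fun j hj i => ?_⟩
  rw [Function.mem_support, autocorrelation_placed] at hj
  obtain ⟨b, -, hb⟩ := Finset.exists_ne_zero_of_sum_ne_zero hj
  obtain ⟨a, -, ha⟩ := Finset.exists_ne_zero_of_sum_ne_zero hb
  have hab : toPixel a = j + toPixel b := by
    by_contra h
    exact ha (if_neg h)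
  have hai := le_corner a i
  have hbi := le_corner b i
  have habs : |((a.1 i : ℤ) - b.1 i)| ≤ (4 * M / 3 : ℕ) := by
    rw [abs_le]
    constructor <;> omega
  rw [coord_eq_of_cast_eq (x := (a.1 i : ℤ) - b.1 i) _ (by push_cast at habs; omega)]
  · exact habs
  · have := congrFun hab i
    simp only [toPixel, Pi.add_apply] at this
    push_cast
    linear_combination -this

theorem sub_mem_centeredCube {f : Image d M} (hf : f ∈ smallAutocorrelationImages d M)
    {j l : Pixel d M} (hj : f j ≠ 0) (hl : f l ≠ 0) (i : Fin d) :
    |coord (j - l) i| ≤ (4 * M / 3 : ℕ) := by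
  refine hf.2 (Function.mem_support.2 (ne_of_gt ?_)) i
  refine Finset.sum_pos' (fun k _ => mul_nonneg (hf.1 _) (hf.1 _)) ⟨l, Finset.mem_univ _, ?_⟩
  rw [sub_add_cancel]
  exact mul_pos (lt_of_le_of_ne (hf.1 l) hl.symm) (lt_of_le_of_ne (hf.1 j) hj.symm)

/-- As `3 * M₀ < 4M + 1`, residues whose pairwise differences are at most `M₀` lie in one interval
of length `M₀` (and not around the whole cycle). -/
theorem exists_eq_placed {f : Image d M} (hf : f ∈ smallAutocorrelationImages d M) :
    ∃ v y, (∀ n, 0 ≤ y n) ∧ f = placed v y := by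
  classical
  suffices h : ∃ v : Pixel d M, ∀ j, f j ≠ 0 → ∃ n : Finset.Iic (corner d M),
      v + toPixel n = j by
    obtain ⟨v, hv⟩ := h
    exact ⟨v, _, fun n => hf.1 _, eq_placed hv⟩
  by_cases h0 : ∀ j, f j = 0
  · exact ⟨0, fun j hj => absurd (h0 j) hj⟩
  push Not at h0
  obtain ⟨p, hp⟩ := h0
  -- `q i` is a support point whose `i`-th coordinate is minimal, measured from `p`
  have hmin : ∀ i, ∃ q, f q ≠ 0 ∧ ∀ j, f j ≠ 0 → coord (q - p) i ≤ coord (j - p) i := by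
    intro i
    obtain ⟨q, hq, hmin⟩ := Finset.exists_min_image (Finset.univ.filter fun j => f j ≠ 0)
      (fun j => coord (j - p) i) ⟨p, by simpa using hp⟩
    exact ⟨q, by simpa using hq, fun j hj => hmin j (by simpa using hj)⟩
  choose q hq hqmin using hmin
  refine ⟨fun i => q i i, fun j hj => ?_⟩
  have hcast : ∀ (k : Pixel d M) i, ((coord k i : ℤ) : ZMod (4 * M + 1)) = k i := fun k i =>
    ZMod.coe_valMinAbs _
  have hdiff : ∀ i, coord (j - p) i - coord (q i - p) i = coord (j - q i) i := by
    intro i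
    have h1 := abs_le.1 (sub_mem_centeredCube hf hj hp i)
    have h2 := abs_le.1 (sub_mem_centeredCube hf (hq i) hp i)
    have h3 := abs_le.1 (sub_mem_centeredCube hf hj (hq i) i)
    have h4 := hqmin i j hj
    have hdvd : ((4 * M + 1 : ℕ) : ℤ) ∣
        coord (j - p) i - coord (q i - p) i - coord (j - q i) i := by
      rw [← ZMod.intCast_zmod_eq_zero_iff_dvd]
      push_cast
      rw [hcast, hcast, hcast]
      simp
    obtain ⟨c, hc⟩ := hdvd
    have hc0 : c = 0 := by
      push_cast at hc h1 h2 h3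
      have hM : (3 : ℤ) * (4 * M / 3) ≤ 4 * M := by omega
      have hlt : (4 * M + 1 : ℤ) * c < (4 * M + 1) * 1 := by omega
      have hgt : (4 * M + 1 : ℤ) * (-1) < (4 * M + 1) * c := by omega
      have hpos : (0 : ℤ) < 4 * M + 1 := by positivity
      have := lt_of_mul_lt_mul_left hlt hpos.le
      have := lt_of_mul_lt_mul_left hgt hpos.le
      omega
    rw [hc0, mul_zero] at hc
    omega
  have hnn : ∀ i, 0 ≤ coord (j - q i) i := fun i => by
    rw [← hdiff]
    exact sub_nonneg.2 (hqmin i j hj)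
  refine ⟨⟨Finsupp.equivFunOnFinite.symm fun i => (coord (j - q i) i).toNat, ?_⟩, ?_⟩
  · refine Finset.mem_Iic.2 fun i => ?_
    have := abs_le.1 (sub_mem_centeredCube hf hj (hq i) i)
    simp only [Finsupp.equivFunOnFinite_symm_apply_apply, corner_apply]
    omega
  · funext i
    have : (((coord (j - q i) i).toNat : ℤ) : ZMod (4 * M + 1)) = (j - q i) i := by
      rw [Int.toNat_of_nonneg (hnn i), hcast]
    simp only [Pi.add_apply, toPixel, Finsupp.equivFunOnFinite_symm_apply_apply]
    rw [Int.cast_natCast] at this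
    rw [this, Pi.sub_apply]
    ring

end SmallImages

/-! ### Finiteness and generic uniqueness -/

section Uniqueness

variable {d M : ℕ}

theorem magnitudeData_eq_of_mem_magnitudeTorus {f g : Image d M}
    (hg : g ∈ magnitudeTorus (magnitudeData f)) : magnitudeData g = magnitudeData f :=
  funext hg

/-- Smallness of the support is visible in the magnitude data: for non-negative images it is a
property of the autocorrelation. -/
theorem exists_eq_placed_of_mem_magnitudeTorus {f g : Image d M}
    (hf : f ∈ smallAutocorrelationImages d M)
    (hg : g ∈ magnitudeTorus (magnitudeData f) ∩ nonnegImages d M) :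
    ∃ w z, (∀ n, 0 ≤ z n) ∧ g = placed w z := by
  refine exists_eq_placed ⟨hg.2, ?_⟩
  rw [autocorrelation_eq_of_magnitudeData_eq (magnitudeData_eq_of_mem_magnitudeTorus hg.1)]
  exact hf.2

theorem autocorrPoly_eq_of_mem_magnitudeTorus {v w : Pixel d M}
    {y z : Finset.Iic (corner d M) → ℝ}
    (hg : placed w z ∈ magnitudeTorus (magnitudeData (placed v y))) :
    autocorrPoly (corner d M) z = autocorrPoly (corner d M) y :=
  autocorrPoly_eq_of_autocorrelation_eq
    (autocorrelation_eq_of_magnitudeData_eq (magnitudeData_eq_of_mem_magnitudeTorus hg))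

theorem finite_magnitudeTorus_inter_nonnegImages {f : Image d M}
    (hf : f ∈ smallAutocorrelationImages d M) :
    (magnitudeTorus (magnitudeData f) ∩ nonnegImages d M).Finite := by
  obtain ⟨v, y, hy, rfl⟩ := exists_eq_placed hf
  refine (Set.finite_iUnion fun w => (finite_nonneg_autocorrPoly_eq (corner d M)
    (autocorrPoly (corner d M) y)).image (placed w)).subset fun g hg => ?_
  obtain ⟨w, z, hz, rfl⟩ := exists_eq_placed_of_mem_magnitudeTorus hf hg
  exact Set.mem_iUnion.2 ⟨w, z, ⟨hz, autocorrPoly_eq_of_mem_magnitudeTorus hg.1⟩, rfl⟩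

theorem placed_mem_trivialAssociates (v w : Pixel d M) (y : Finset.Iic (corner d M) → ℝ) :
    placed w y ∈ trivialAssociates (placed v y) := by
  refine ⟨w - v, Or.inl fun j => ?_⟩
  rw [placed_sub, add_sub_cancel]

theorem placed_comp_boxRev_mem_trivialAssociates (v w : Pixel d M)
    (y : Finset.Iic (corner d M) → ℝ) :
    placed w (y ∘ boxRev (corner d M)) ∈ trivialAssociates (placed v y) := by
  refine ⟨(w + w + fun _ => ((4 * M / 3 : ℕ) : ZMod (4 * M + 1))) - (w - v),
    Or.inr fun j => ?_⟩
  rw [placed_comp_boxRev, sub_right_comm, placed_sub v (w - v), add_sub_cancel]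

/-- A non-zero polynomial does not vanish identically on any orthant near its apex. -/
theorem mem_closure_lt_eval_ne_zero {ι : Type*} [Fintype ι] {q : MvPolynomial ι ℝ} (hq : q ≠ 0)
    (y : ι → ℝ) : y ∈ closure {z | (∀ n, y n < z n) ∧ eval z q ≠ 0} := by
  refine Metric.mem_closure_iff.2 fun ε hε => ?_
  by_contra! h
  refine hq (funext_set (fun n => Set.Ioo (y n) (y n + ε)) (fun n => Set.Ioo_infinite (by simpa))
    fun z hz => ?_)
  rw [map_zero]
  by_contra h0
  refine absurd (h z ⟨fun n => (hz n trivial).1, h0⟩) (not_le.2 ((dist_pi_lt_iff hε).2 fun n => ?_))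
  have := hz n trivial
  rw [Real.dist_eq, abs_lt]
  constructor <;> linarith [this.1, this.2]

theorem continuous_placed (v : Pixel d M) : Continuous (placed v) := by
  refine continuous_pi fun j => continuous_finsetSum _ fun n _ => ?_
  split_ifs
  exacts [continuous_apply n, continuous_const]

/-- An image with small autocorrelation that vanishes nowhere on one cube is supported on it. -/
theorem eq_placed_of_forall_ne_zero {f : Image d M} (hf : f ∈ smallAutocorrelationImages d M)
    {u : Pixel d M} (hu : ∀ n, f (u + toPixel n) ≠ 0) :
    f = placed u fun n => f (u + toPixel n) := by
  obtain ⟨v, y, -, rfl⟩ := exists_eq_placed hf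
  have hsub : ∀ n : Finset.Iic (corner d M), ∃ n', v + toPixel n' = u + toPixel n := by
    intro n
    by_contra! h
    exact hu n (placed_eq_zero y h)
  choose e he using hsub
  have hinj : Function.Injective e := fun a b hab =>
    toPixel_injective (add_left_cancel ((he a).symm.trans (hab ▸ he b)))
  refine eq_placed fun j hj => ?_
  by_contra! h
  refine hj (placed_eq_zero y fun n' hn' => ?_)
  obtain ⟨n, rfl⟩ := (Finite.injective_iff_surjective.1 hinj) n'
  exact h n ((he n).symm.trans hn')

theorem holdsGenerically_subset_trivialAssociates (hd : 2 ≤ d) (hM : 1 ≤ M) :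
    HoldsGenerically (smallAutocorrelationImages d M)
      (fun f => magnitudeTorus (magnitudeData f) ∩ nonnegImages d M ⊆ trivialAssociates f) := by
  have : Nontrivial (Fin d) := Fin.nontrivial_iff_two_le.2 hd
  have ht : ∀ i, 0 < corner d M i := fun i => by
    rw [corner_apply]
    omega
  obtain ⟨r, hr0, hr⟩ := exists_irreducible_boxPoly (K := ℝ) ht
  let q : MvPolynomial (Finset.Iic (corner d M)) ℝ := r * ∏ n, X n
  have hq0 : q ≠ 0 := mul_ne_zero hr0 (Finset.prod_ne_zero_iff.2 fun n _ => X_ne_zero n)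
  -- The cones of the translated cubes need one polynomial. A product over the cubes could vanish
  -- on all of them; the sum of squares is non-zero where some summand is, and the factors `X n` of
  -- `q` ensure that it is the one that belongs to the support of the image.
  let p : MvPolynomial (Pixel d M) ℝ := ∑ u, rename (fun n => u + toPixel n) q ^ 2
  have hp : ∀ f : Image d M, eval f p = ∑ u, eval (fun n => f (u + toPixel n)) q ^ 2 := by
    intro f
    simp only [p, map_sum, map_pow, eval_rename]
    rfl
  refine ⟨p, fun f hf => ?_, fun f hf hpf g hg => ?_⟩
  · obtain ⟨v, y, hy, rfl⟩ := exists_eq_placed hf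
    refine map_mem_closure (continuous_placed v) (mem_closure_lt_eval_ne_zero hq0 y) ?_
    rintro z ⟨hyz, hz⟩
    refine ⟨placed_mem_smallAutocorrelationImages v fun n => (hy n).trans (hyz n).le, ?_⟩
    rw [hp]
    refine ne_of_gt (Finset.sum_pos' (fun u _ => sq_nonneg _) ⟨v, Finset.mem_univ _, ?_⟩)
    simp only [placed_add_toPixel]
    positivity
  · rw [hp] at hpf
    obtain ⟨u, -, hu⟩ := Finset.exists_ne_zero_of_sum_ne_zero hpf
    have hqu := (pow_ne_zero_iff two_ne_zero).1 hu
    rw [map_mul, map_prod] at hqu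
    have hne : ∀ n, f (u + toPixel n) ≠ 0 := fun n => by
      simpa using Finset.prod_ne_zero_iff.1 (right_ne_zero_of_mul hqu) n (Finset.mem_univ n)
    obtain ⟨y, rfl, hy, hy0, hirr⟩ : ∃ y, f = placed u y ∧ (∀ n, 0 ≤ y n) ∧ (∀ n, y n ≠ 0) ∧
        Irreducible (boxPoly (corner d M) y) :=
      ⟨_, eq_placed_of_forall_ne_zero hf hne, fun n => hf.1 _, hne,
        hr _ hne (left_ne_zero_of_mul hqu)⟩
    obtain ⟨w, z, hz, rfl⟩ := exists_eq_placed_of_mem_magnitudeTorus hf hg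
    rcases eq_or_eq_comp_boxRev_of_irreducible hy (hy0 _) hz hirr
      (autocorrPoly_eq_of_mem_magnitudeTorus hg.1) with rfl | rfl
    · exact placed_mem_trivialAssociates _ _ _
    · exact placed_comp_boxRev_mem_trivialAssociates _ _ _

end Uniqueness

end PhaseRetrieval

theorem mainTheorem4 (d M : ℕ) (hd : 1 ≤ d) (hM : 1 ≤ M) :
    (∀ f ∈ PhaseRetrieval.smallAutocorrelationImages d M,
      (PhaseRetrieval.magnitudeTorus (PhaseRetrieval.magnitudeData f) ∩
        PhaseRetrieval.nonnegImages d M).Finite) ∧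
    (2 ≤ d →
      PhaseRetrieval.HoldsGenerically (PhaseRetrieval.smallAutocorrelationImages d M)
        (fun f => PhaseRetrieval.magnitudeTorus (PhaseRetrieval.magnitudeData f) ∩
          PhaseRetrieval.nonnegImages d M ⊆ PhaseRetrieval.trivialAssociates f)) :=
  ⟨fun _ hf => PhaseRetrieval.finite_magnitudeTorus_inter_nonnegImages hf,
    fun hd2 => PhaseRetrieval.holdsGenerically_subset_trivialAssociates hd2 hM⟩
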